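/- A digraph is a finite directed graph $G=(V(G),E(G))$, possibly with loops and possibly with no vertices. A map $f:V(G)^n\to V(G)$ is a polymorphism of $G$ if $(u_1,v_1),\dots,(u_n,v_n)\in E(G)$ implies $(f(u_1,\dots,u_n),f(v_1,\dots,v_n))\in E(G)$. The algebra of all polymorphisms of $G$ has universe $V(G)$ and the polymorphisms of $G$ (of all arities) as its basic operations. A variety is a class of algebras of the same signature that is closed under homomorphic images, subalgebras and direct products; the variety generated by an algebra is the smallest variety that contains it. (The empty algebra is allowed.) A class of algebras is congruence permutable if $\theta\circ\varphi=\varphi\circ\theta$ for any two congruences $\theta,\varphi$ of any of its members, congruence distributive if the congruence lattice of each of its members is distributive, and arithmetic if it is both congruence permutable and congruence distributive. **Corollary.** Let $G$ be a digraph and let $\mathcal V$ be the variety generated by the algebra of all polymorphisms of $G$. Then $\mathcal V$ is congruence permutable if and only if $\mathcal V$ is arithmetic. -/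

import Mathlib

open FirstOrder CategoryTheory

universe u v w

namespace UniversalAlgebra

open FirstOrder.Language (Structure)

/-! ### Congruences of algebras

An algebra is a first-order structure over a language `L` without relation symbols
(`L.IsAlgebraic`); the function symbols of `L`, with their arities, form the signature. -/

/-- A congruence of an algebra: an equivalence relation preserved by all basic operations. -/
structure Congruence (L : FirstOrder.Language.{u, v}) (M : Type w) [L.Structure M] extends Setoid M where
  /-- Every basic operation preserves the equivalence relation. -/
  funMap_rel : ∀ {n : ℕ} (f : L.Functions n) (x y : Fin n → M),
    (∀ i, toSetoid.r (x i) (y i)) → toSetoid.r (Structure.funMap f x) (Structure.funMap f y)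

namespace Congruence

variable {L : FirstOrder.Language.{u, v}} {M : Type w} [L.Structure M]

theorem toSetoid_injective :
    Function.Injective (toSetoid : Congruence L M → Setoid M) := by
  rintro ⟨r, hr⟩ ⟨s, hs⟩ h
  cases h
  rfl

/-- Congruences are ordered by inclusion. -/
instance : PartialOrder (Congruence L M) :=
  PartialOrder.lift toSetoid toSetoid_injective

/-- The infimum of a set of congruences is their intersection. -/
instance : InfSet (Congruence L M) where
  sInf S :=
    { toSetoid := sInf (toSetoid '' S)
      funMap_rel := by
        rintro n f x y h _ ⟨θ, hθ, rfl⟩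
        exact θ.funMap_rel f x y fun i => h i _ (Set.mem_image_of_mem _ hθ) }

/-- The congruence lattice of an algebra. The join of two congruences is the smallest congruence
containing both. -/
instance : CompleteLattice (Congruence L M) :=
  completeLatticeOfInf (Congruence L M) fun S =>
    ⟨fun θ hθ _ _ h => h _ (Set.mem_image_of_mem _ hθ), by
      rintro φ hφ a b h _ ⟨θ, hθ, rfl⟩
      exact hφ hθ h⟩

end Congruence

/-! ### Classes of algebras and varieties -/

/-- The direct product of a family of structures, with coordinatewise operations. -/
instance productStructure {L : FirstOrder.Language.{u, v}} {I : Type w} (A : I → Bundled.{w} L.Structure) :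
    L.Structure (∀ i, A i) where
  funMap f x i := Structure.funMap f fun k => x k i
  RelMap r x := ∀ i, Structure.RelMap r fun k => x k i

/-- A class of algebras is a variety if it is closed under homomorphic images, subalgebras and
direct products (of families indexed by arbitrary sets). -/
structure IsVariety {L : FirstOrder.Language.{u, v}} [L.IsAlgebraic] (K : Set (Bundled.{w} L.Structure)) :
    Prop where
  /-- Closure under homomorphic images. -/
  image : ∀ (A B : Bundled.{w} L.Structure) (f : A →[L] B),
    Function.Surjective f → A ∈ K → B ∈ K
  /-- Closure under subalgebras. -/
  subalgebra : ∀ (A : Bundled.{w} L.Structure) (S : L.Substructure A),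
    A ∈ K → Bundled.of (c := L.Structure) S ∈ K
  /-- Closure under direct products. -/
  product : ∀ (I : Type w) (A : I → Bundled.{w} L.Structure),
    (∀ i, A i ∈ K) → Bundled.of (c := L.Structure) (∀ i, A i) ∈ K

/-- The variety generated by an algebra `A`: the smallest variety containing `A`. -/
def varietyGeneratedBy {L : FirstOrder.Language.{u, v}} [L.IsAlgebraic] (A : Bundled.{w} L.Structure) :
    Set (Bundled.{w} L.Structure) :=
  ⋂₀ {K | IsVariety K ∧ A ∈ K}

/-- A class of algebras is congruence permutable if any two congruences `θ`, `φ` of any of its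
members satisfy `θ ∘ φ = φ ∘ θ`. -/
def IsCongruencePermutable {L : FirstOrder.Language.{u, v}} (K : Set (Bundled.{w} L.Structure)) : Prop :=
  ∀ A ∈ K, ∀ θ φ : Congruence L A, Relation.Comp θ.r φ.r = Relation.Comp φ.r θ.r

/-- A class of algebras is congruence distributive if the congruence lattice of each of its members
is distributive. -/
def IsCongruenceDistributive {L : FirstOrder.Language.{u, v}} (K : Set (Bundled.{w} L.Structure)) : Prop :=
  ∀ A ∈ K, ∀ θ φ ψ : Congruence L A, θ ⊓ (φ ⊔ ψ) = (θ ⊓ φ) ⊔ (θ ⊓ ψ)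

/-- A class of algebras is arithmetic if it is both congruence permutable and congruence
distributive. -/
def IsArithmetic {L : FirstOrder.Language.{u, v}} (K : Set (Bundled.{w} L.Structure)) : Prop :=
  IsCongruencePermutable K ∧ IsCongruenceDistributive K

/-! ### The algebra of polymorphisms of a digraph -/

/-- `f : V ^ n → V` is a polymorphism of `G` if it is compatible with the edge relation. -/
def IsPolymorphism {V : Type u} (G : Digraph V) {n : ℕ} (f : (Fin n → V) → V) : Prop :=
  ∀ x y : Fin n → V, (∀ i, G.Adj (x i) (y i)) → G.Adj (f x) (f y)

/-- The signature with one `n`-ary operation symbol for each `n`-ary polymorphism of `G`. -/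
def polymorphismLanguage {V : Type u} (G : Digraph V) : FirstOrder.Language.{u, 0} where
  Functions n := {f : (Fin n → V) → V // IsPolymorphism G f}
  Relations _ := Empty

instance {V : Type u} (G : Digraph V) : (polymorphismLanguage G).IsAlgebraic :=
  fun _ => inferInstanceAs (IsEmpty Empty)

/-- The algebra of all polymorphisms of `G`: the universe is the vertex set and the basic operations
are all polymorphisms of `G`. -/
def polymorphismAlgebra {V : Type u} (G : Digraph V) :
    Bundled.{u} (polymorphismLanguage G).Structure where
  α := V
  str :=
    { funMap := fun f x => f.1 x
      RelMap := fun r _ => r.elim }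

end UniversalAlgebra

namespace UniversalAlgebra

open FirstOrder.Language (Structure)

/-! ### Ternary polymorphisms of digraphs -/

/-! Only distributivity needs proof. In the ternary polymorphisms, a subalgebra of a power of the
polymorphism algebra, permutability of two congruences yields a Maltsev polymorphism
(`exists_maltsev_of_isCongruencePermutable`). The combinatorial core is that a finite digraph with a
Maltsev polymorphism has a majority polymorphism. Such a digraph is rectangular, so its nonempty
out-neighbourhoods are disjoint and form a digraph that is again Maltsev. If it has fewer vertices,
induction gives it a majority polymorphism, which lifts; otherwise the edges are the graph of a
permutation. The majority identities pass to the whole variety and, with permutability, force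
distributivity (`Congruence.inf_sup_of_majority`). -/

/-- A ternary operation compatible with the edge relation of a digraph. -/
def IsTernaryPolymorphism {V : Type u} (G : Digraph V) (f : V → V → V → V) : Prop :=
  ∀ ⦃a b c a' b' c' : V⦄, G.Adj a a' → G.Adj b b' → G.Adj c c' → G.Adj (f a b c) (f a' b' c')

/-- The Maltsev identities. -/
def IsMaltsev {V : Type u} (f : V → V → V → V) : Prop :=
  (∀ a b, f a b b = a) ∧ ∀ a b, f a a b = b

/-- The majority identities. -/
def IsMajority {V : Type u} (f : V → V → V → V) : Prop :=
  (∀ a b, f a a b = a) ∧ (∀ a b, f a b a = a) ∧ ∀ a b, f b a a = a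

/-- The set of out-neighbours of a vertex. -/
def outNeighbors {V : Type u} (G : Digraph V) (x : V) : Set V := {y | G.Adj x y}

/-- The nonempty sets of the form `outNeighbors G x`. -/
def OutClass {V : Type u} (G : Digraph V) : Type u :=
  {s : Set V // s.Nonempty ∧ ∃ x, outNeighbors G x = s}

instance {V : Type u} [Finite V] (G : Digraph V) : Finite (OutClass G) :=
  inferInstanceAs (Finite {s : Set V // s.Nonempty ∧ ∃ x, outNeighbors G x = s})

/-- The digraph on the out-neighbourhoods in which `s → t` if `t` is the out-neighbourhood of an
element of `s`. -/
def outClassDigraph {V : Type u} (G : Digraph V) : Digraph (OutClass G) where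
  Adj s t := ∃ y ∈ s.1, outNeighbors G y = t.1

/-- A digraph is rectangular if any two vertices with a common out-neighbour have the same
out-neighbours. -/
def IsRectangular {V : Type u} (G : Digraph V) : Prop :=
  ∀ ⦃x y z : V⦄, G.Adj x z → G.Adj y z → outNeighbors G x = outNeighbors G y

section

variable {V : Type u} {G : Digraph V}

/-- Apply `m` to the edges y → z, x → z, x → w: the tails give m(y,x,x) = y and the heads m(z,z,w) =
w. -/
theorem IsMaltsev.isRectangular {m : V → V → V → V} (hm : IsMaltsev m)
    (hG : IsTernaryPolymorphism G m) : IsRectangular G := by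
  intro x y z hx hy
  ext w
  constructor
  · intro hw
    have := hG hy hx hw
    rwa [hm.1, hm.2] at this
  · intro hw
    have := hG hx hy hw
    rwa [hm.1, hm.2] at this

/-- A shared element is a common out-neighbour of the vertices defining the two sets. So a vertex
lies in at most one class, which makes the lifting below well defined. -/
theorem IsRectangular.outClass_eq (hG : IsRectangular G) {s t : OutClass G} {x : V}
    (hs : x ∈ s.1) (ht : x ∈ t.1) : s = t := by
  obtain ⟨s, hs', a, rfl⟩ := s
  obtain ⟨t, ht', b, rfl⟩ := t
  exact Subtype.ext (hG hs ht)

/-- A Maltsev polymorphism of a digraph induces one of the digraph of out-neighbourhoods. -/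
theorem exists_maltsev_outClassDigraph {m : V → V → V → V} (hm : IsMaltsev m)
    (hG : IsTernaryPolymorphism G m) :
    ∃ m', IsMaltsev m' ∧ IsTernaryPolymorphism (outClassDigraph G) m' := by
  have hR := hm.isRectangular hG
  choose rep hrep using fun s : OutClass G => s.2.2
  have hadj : ∀ (s : OutClass G) (y : V), y ∈ s.1 → G.Adj (rep s) y := by
    intro s y hy
    rw [← hrep s] at hy
    exact hy
  refine ⟨fun s t r => ⟨outNeighbors G (m (rep s) (rep t) (rep r)), ?_, _, rfl⟩,
    ⟨?_, ?_⟩, ?_⟩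
  · obtain ⟨a, ha⟩ := s.2.1
    obtain ⟨b, hb⟩ := t.2.1
    obtain ⟨c, hc⟩ := r.2.1
    exact ⟨_, hG (hadj s a ha) (hadj t b hb) (hadj r c hc)⟩
  · intro s t
    exact Subtype.ext (by simp only [hm.1, hrep])
  · intro s t
    exact Subtype.ext (by simp only [hm.2, hrep])
  · rintro s t r s' t' r' ⟨x, hx, hx'⟩ ⟨y, hy, hy'⟩ ⟨z, hz, hz'⟩
    refine ⟨m x y z, hG (hadj s x hx) (hadj t y hy) (hadj r z hz), ?_⟩
    obtain ⟨a, ha⟩ := s'.2.1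
    obtain ⟨b, hb⟩ := t'.2.1
    obtain ⟨c, hc⟩ := r'.2.1
    -- Both m(x,y,z) and m of the representatives of s', t', r' have m(a,b,c) as an out-neighbour.
    refine hR (hG (?_ : G.Adj x a) (?_ : G.Adj y b) (?_ : G.Adj z c))
      (hG (hadj s' a ha) (hadj t' b hb) (hadj r' c hc))
    · rw [← hx'] at ha; exact ha
    · rw [← hy'] at hb; exact hb
    · rw [← hz'] at hc; exact hc

/-- A majority polymorphism of the digraph of out-neighbourhoods lifts to a rectangular digraph. -/
theorem IsRectangular.exists_majority_of_outClassDigraph (hR : IsRectangular G)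
    {M : OutClass G → OutClass G → OutClass G → OutClass G} (hM : IsMajority M)
    (hG : IsTernaryPolymorphism (outClassDigraph G) M) :
    ∃ f, IsMajority f ∧ IsTernaryPolymorphism G f := by
  -- The last two clauses prescribe the out-neighbourhood of `w` and the class containing `w`. They
  -- serve (x,y,z) as tails and as heads of edges respectively, so `w` can be chosen separately for
  -- each triple.
  have key : ∀ x y z : V, ∃ w, (x = y → w = x) ∧ (x = z → w = x) ∧ (y = z → w = y) ∧
      (∀ s t r : OutClass G, outNeighbors G x = s.1 → outNeighbors G y = t.1 →
        outNeighbors G z = r.1 → outNeighbors G w = (M s t r).1) ∧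
      (∀ s t r : OutClass G, x ∈ s.1 → y ∈ t.1 → z ∈ r.1 → w ∈ (M s t r).1) := by
    intro x y z
    by_cases hxy : x = y
    · subst hxy
      refine ⟨x, fun _ => rfl, fun _ => rfl, fun _ => rfl, ?_, ?_⟩
      · intro s t r hs ht _
        obtain rfl : s = t := Subtype.ext (hs.symm.trans ht)
        rw [hM.1, hs]
      · intro s t r hs ht _
        obtain rfl := hR.outClass_eq hs ht
        rwa [hM.1]
    by_cases hxz : x = z
    · subst hxz
      refine ⟨x, fun _ => rfl, fun _ => rfl, fun h => h.symm, ?_, ?_⟩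
      · intro s t r hs _ ht
        obtain rfl : s = r := Subtype.ext (hs.symm.trans ht)
        rw [hM.2.1, hs]
      · intro s t r hs _ ht
        obtain rfl := hR.outClass_eq hs ht
        rwa [hM.2.1]
    by_cases hyz : y = z
    · subst hyz
      refine ⟨y, fun h => h.symm, fun h => h.symm, fun _ => rfl, ?_, ?_⟩
      · intro s t r _ hs ht
        obtain rfl : t = r := Subtype.ext (hs.symm.trans ht)
        rw [hM.2.2, hs]
      · intro s t r _ hs ht
        obtain rfl := hR.outClass_eq hs ht
        rwa [hM.2.2]
    have hout : ∀ {s t r s' t' r' : OutClass G}, outNeighbors G x = s.1 →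
        outNeighbors G y = t.1 → outNeighbors G z = r.1 → outNeighbors G x = s'.1 →
        outNeighbors G y = t'.1 → outNeighbors G z = r'.1 → M s t r = M s' t' r' := by
      intro s t r s' t' r' h₁ h₂ h₃ h₁' h₂' h₃'
      rw [Subtype.ext (h₁.symm.trans h₁'), Subtype.ext (h₂.symm.trans h₂'),
        Subtype.ext (h₃.symm.trans h₃')]
    have hin : ∀ {s t r s' t' r' : OutClass G}, x ∈ s.1 → y ∈ t.1 → z ∈ r.1 →
        x ∈ s'.1 → y ∈ t'.1 → z ∈ r'.1 → M s t r = M s' t' r' := by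
      intro s t r s' t' r' h₁ h₂ h₃ h₁' h₂' h₃'
      rw [hR.outClass_eq h₁ h₁', hR.outClass_eq h₂ h₂', hR.outClass_eq h₃ h₃']
    suffices ∃ w, (∀ s t r : OutClass G, outNeighbors G x = s.1 → outNeighbors G y = t.1 →
        outNeighbors G z = r.1 → outNeighbors G w = (M s t r).1) ∧
        (∀ s t r : OutClass G, x ∈ s.1 → y ∈ t.1 → z ∈ r.1 → w ∈ (M s t r).1) by
      obtain ⟨w, h₁, h₂⟩ := this
      exact ⟨w, fun h => absurd h hxy, fun h => absurd h hxz, fun h => absurd h hyz, h₁, h₂⟩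
    by_cases ho : ∃ s t r : OutClass G, outNeighbors G x = s.1 ∧ outNeighbors G y = t.1 ∧
        outNeighbors G z = r.1
    · obtain ⟨s, t, r, hs, ht, hr⟩ := ho
      by_cases hi : ∃ s t r : OutClass G, x ∈ s.1 ∧ y ∈ t.1 ∧ z ∈ r.1
      · obtain ⟨s', t', r', hs', ht', hr'⟩ := hi
        -- The class of a vertex has an edge to its out-neighbourhood. `M` preserves these edges,
        -- and a witness of the resulting edge meets both demands.
        obtain ⟨w, hw, hw'⟩ : (outClassDigraph G).Adj (M s' t' r') (M s t r) :=
          hG ⟨x, hs', hs⟩ ⟨y, ht', ht⟩ ⟨z, hr', hr⟩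
        refine ⟨w, fun a b c ha hb hc => ?_, fun a b c ha hb hc => ?_⟩
        · rw [hw', hout hs ht hr ha hb hc]
        · rwa [hin ha hb hc hs' ht' hr']
      · obtain ⟨w, hw⟩ := (M s t r).2.2
        refine ⟨w, fun a b c ha hb hc => ?_, fun a b c ha hb hc =>
          absurd ⟨a, b, c, ha, hb, hc⟩ hi⟩
        rw [hw, hout hs ht hr ha hb hc]
    · by_cases hi : ∃ s t r : OutClass G, x ∈ s.1 ∧ y ∈ t.1 ∧ z ∈ r.1
      · obtain ⟨s', t', r', hs', ht', hr'⟩ := hi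
        obtain ⟨w, hw⟩ := (M s' t' r').2.1
        refine ⟨w, fun a b c ha hb hc => absurd ⟨a, b, c, ha, hb, hc⟩ ho,
          fun a b c ha hb hc => ?_⟩
        rwa [hin ha hb hc hs' ht' hr']
      · exact ⟨x, fun a b c ha hb hc => absurd ⟨a, b, c, ha, hb, hc⟩ ho,
          fun a b c ha hb hc => absurd ⟨a, b, c, ha, hb, hc⟩ hi⟩
  choose f hxy hxz hyz ho hi using key
  refine ⟨f, ⟨fun a b => hxy a a b rfl, fun a b => hxz a b a rfl, fun a b => hyz b a a rfl⟩, ?_⟩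
  intro a b c a' b' c' ha hb hc
  have h₁ := ho a b c ⟨outNeighbors G a, ⟨a', ha⟩, a, rfl⟩ ⟨outNeighbors G b, ⟨b', hb⟩, b, rfl⟩
    ⟨outNeighbors G c, ⟨c', hc⟩, c, rfl⟩ rfl rfl rfl
  have h₂ := hi a' b' c' ⟨outNeighbors G a, ⟨a', ha⟩, a, rfl⟩
    ⟨outNeighbors G b, ⟨b', hb⟩, b, rfl⟩ ⟨outNeighbors G c, ⟨c', hc⟩, c, rfl⟩ ha hb hc
  rw [← h₁] at h₂
  exact h₂

/-- A digraph whose in-degrees and out-degrees are at most one has a majority polymorphism. -/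
theorem exists_majority_of_unique (hout : ∀ ⦃x y y'⦄, G.Adj x y → G.Adj x y' → y = y')
    (hin : ∀ ⦃x x' y⦄, G.Adj x y → G.Adj x' y → x = x') :
    ∃ f, IsMajority f ∧ IsTernaryPolymorphism G f := by
  classical
  -- The edges form a partial injection, so two tails are equal exactly when their heads are.
  refine ⟨fun x y z => if y = z then y else x, ⟨?_, ?_, ?_⟩, ?_⟩
  · intro a b
    simp
  · intro a b
    dsimp only
    split_ifs with h
    · exact h
    · rfl
  · intro a b
    simp
  · intro a b c a' b' c' ha hb hc
    by_cases h : b = c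
    · subst h
      obtain rfl := hout hb hc
      simpa using hb
    · have h' : b' ≠ c' := by
        rintro rfl
        exact h (hin hb hc)
      simpa [h, h'] using ha

/-- A rectangular digraph with at least as many out-neighbourhoods as vertices has in-degrees
and out-degrees at most one, hence a majority polymorphism. -/
theorem IsRectangular.exists_majority_of_card_le [Finite V] (hR : IsRectangular G)
    (hcard : Nat.card V ≤ Nat.card (OutClass G)) :
    ∃ f, IsMajority f ∧ IsTernaryPolymorphism G f := by
  choose rep hrep using fun s : OutClass G => s.2.2
  have hrep_inj : Function.Injective rep := fun s t h =>
    Subtype.ext ((hrep s).symm.trans ((congrArg _ h).trans (hrep t)))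
  -- By counting, every vertex represents a class: out-neighbourhoods are nonempty and pairwise
  -- distinct.
  have hrep_bij : Function.Bijective rep :=
    hrep_inj.bijective_of_nat_card_le hcard
  have hin : ∀ ⦃x x' y⦄, G.Adj x y → G.Adj x' y → x = x' := by
    intro x x' y hx hx'
    obtain ⟨s, rfl⟩ := hrep_bij.2 x
    obtain ⟨t, rfl⟩ := hrep_bij.2 x'
    have := hR hx hx'
    rw [hrep, hrep] at this
    rw [Subtype.ext this]
  have hne : ∀ x, ∃ y, G.Adj x y := by
    intro x
    obtain ⟨s, rfl⟩ := hrep_bij.2 x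
    obtain ⟨y, hy⟩ := s.2.1
    rw [← hrep s] at hy
    exact ⟨y, hy⟩
  choose σ hσ using hne
  -- An injective `σ` on a finite set is onto, so each vertex already has its unique in-neighbour
  -- through `σ`; no other edges exist.
  have hσ_inj : Function.Injective σ := fun x y h => hin (hσ x) (h ▸ hσ y)
  have hσ_surj := Finite.surjective_of_injective hσ_inj
  have huniq : ∀ x y, G.Adj x y → y = σ x := by
    intro x y h
    obtain ⟨z, rfl⟩ := hσ_surj y
    rw [hin h (hσ z)]
  exact exists_majority_of_unique
    (fun x y y' h h' => (huniq x y h).trans (huniq x y' h').symm) hin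

end

/-- A finite digraph with a Maltsev polymorphism has a majority polymorphism. -/
theorem exists_majority_of_maltsev {V : Type u} [Finite V] (G : Digraph V)
    (h : ∃ m, IsMaltsev m ∧ IsTernaryPolymorphism G m) :
    ∃ f, IsMajority f ∧ IsTernaryPolymorphism G f := by
  induction hn : Nat.card V using Nat.strong_induction_on generalizing V with
  | _ n ih =>
    subst hn
    obtain ⟨m, hm, hG⟩ := h
    have hR := hm.isRectangular hG
    rcases le_or_gt (Nat.card V) (Nat.card (OutClass G)) with hle | hlt
    · exact hR.exists_majority_of_card_le hle
    · obtain ⟨M, hM, hM'⟩ :=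
        ih _ hlt (outClassDigraph G) (exists_maltsev_outClassDigraph hm hG) rfl
      exact hR.exists_majority_of_outClassDigraph hM hM'

/-! ### Congruence lattices -/

namespace Congruence

variable {L : FirstOrder.Language.{u, v}} {M : Type w} [L.Structure M]

theorem inf_r {θ φ : Congruence L M} {a b : M} (h₁ : θ.r a b) (h₂ : φ.r a b) :
    (θ ⊓ φ).r a b := by
  rintro _ ⟨ψ, rfl | rfl, rfl⟩
  · exact h₁
  · exact h₂

/-- The relational product of two permuting congruences. -/
def compOfPermutes (θ φ : Congruence L M)
    (h : Relation.Comp θ.r φ.r = Relation.Comp φ.r θ.r) : Congruence L M where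
  r := Relation.Comp θ.r φ.r
  iseqv :=
    { refl := fun a => ⟨a, θ.iseqv.refl a, φ.iseqv.refl a⟩
      symm := by
        rintro a b ⟨c, hac, hcb⟩
        rw [h]
        exact ⟨c, φ.iseqv.symm hcb, θ.iseqv.symm hac⟩
      trans := by
        rintro a b c ⟨d, had, hdb⟩ ⟨e, hbe, hec⟩
        have : Relation.Comp θ.r φ.r d e := by
          rw [h]
          exact ⟨b, hdb, hbe⟩
        obtain ⟨g, hdg, hge⟩ := this
        exact ⟨g, θ.iseqv.trans had hdg, φ.iseqv.trans hge hec⟩ }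
  funMap_rel := by
    intro n f x y hxy
    choose z hxz hzy using hxy
    exact ⟨Structure.funMap f z, θ.funMap_rel f x z hxz, φ.funMap_rel f z y hzy⟩

/-- The relational product is itself a congruence above both, hence above their join. -/
theorem sup_r_of_permutes {θ φ : Congruence L M}
    (h : Relation.Comp θ.r φ.r = Relation.Comp φ.r θ.r) {a b : M} (hab : (θ ⊔ φ).r a b) :
    Relation.Comp θ.r φ.r a b := by
  have hle : θ ⊔ φ ≤ compOfPermutes θ φ h :=
    sup_le (fun x y hxy => ⟨y, hxy, φ.iseqv.refl y⟩) (fun x y hxy => ⟨x, θ.iseqv.refl x, hxy⟩)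
  exact hle hab

end Congruence

/-- An algebra with permuting congruences and a basic majority operation has a distributive
congruence lattice. -/
theorem Congruence.inf_sup_of_majority {L : FirstOrder.Language.{u, v}} {M : Type w}
    [L.Structure M] (F : L.Functions 3)
    (hF : IsMajority fun a b c : M => Structure.funMap F ![a, b, c])
    (hperm : ∀ θ φ : Congruence L M, Relation.Comp θ.r φ.r = Relation.Comp φ.r θ.r)
    (θ φ ψ : Congruence L M) : θ ⊓ (φ ⊔ ψ) = (θ ⊓ φ) ⊔ (θ ⊓ ψ) := by
  refine le_antisymm ?_ le_inf_sup
  intro a c hac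
  have hθ : θ.r a c := (inf_le_left : θ ⊓ (φ ⊔ ψ) ≤ θ) hac
  obtain ⟨b, hab, hbc⟩ :=
    sup_r_of_permutes (hperm φ ψ) ((inf_le_right : θ ⊓ (φ ⊔ ψ) ≤ φ ⊔ ψ) hac)
  have hcompat : ∀ (χ : Congruence L M) {x y z x' y' z' : M}, χ.r x x' → χ.r y y' → χ.r z z' →
      χ.r (Structure.funMap F ![x, y, z]) (Structure.funMap F ![x', y', z']) := by
    intro χ x y z x' y' z' hx hy hz
    refine χ.funMap_rel F _ _ fun i => ?_
    fin_cases i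
    exacts [hx, hy, hz]
  -- The majority value of a, b, c links a to c: comparing it with F(a,b,a) = a, F(a,a,c) = a and
  -- F(a,c,c) = c gives the θ, φ and ψ relations.
  have h₁ : θ.r a (Structure.funMap F ![a, b, c]) := by
    have := hcompat θ (θ.iseqv.refl a) (θ.iseqv.refl b) hθ
    rwa [show Structure.funMap F _ = _ from hF.2.1 a b] at this
  have h₂ : φ.r a (Structure.funMap F ![a, b, c]) := by
    have := hcompat φ (φ.iseqv.refl a) hab (φ.iseqv.refl c)
    rwa [show Structure.funMap F _ = _ from hF.1 a c] at this
  have h₃ : ψ.r (Structure.funMap F ![a, b, c]) c := by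
    have := hcompat ψ (ψ.iseqv.refl a) hbc (ψ.iseqv.refl c)
    rwa [show Structure.funMap F _ = _ from hF.2.2 c a] at this
  have h₄ : (θ ⊓ φ).r a (Structure.funMap F ![a, b, c]) := inf_r h₁ h₂
  have h₅ : (θ ⊓ ψ).r (Structure.funMap F ![a, b, c]) c :=
    inf_r (θ.iseqv.trans (θ.iseqv.symm h₁) hθ) h₃
  exact ((θ ⊓ φ) ⊔ (θ ⊓ ψ)).iseqv.trans
    ((le_sup_left : θ ⊓ φ ≤ (θ ⊓ φ) ⊔ (θ ⊓ ψ)) h₄)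
    ((le_sup_right : θ ⊓ ψ ≤ (θ ⊓ φ) ⊔ (θ ⊓ ψ)) h₅)

/-! ### Varieties -/

section

variable {L : FirstOrder.Language.{u, v}} [L.IsAlgebraic]

theorem isVariety_varietyGeneratedBy (A : Bundled.{w} L.Structure) :
    IsVariety (varietyGeneratedBy A) where
  image B C f hf hB K hK := hK.1.image B C f hf (hB K hK)
  subalgebra B S hB K hK := hK.1.subalgebra B S (hB K hK)
  product I B hB K hK := hK.1.product I B fun i => hB i K hK

theorem mem_varietyGeneratedBy (A : Bundled.{w} L.Structure) : A ∈ varietyGeneratedBy A :=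
  fun _ hK => hK.2

/-- The algebras in which a given ternary symbol is a majority operation form a variety. -/
theorem isVariety_majority (F : L.Functions 3) :
    IsVariety {A : Bundled.{w} L.Structure |
      IsMajority fun a b c : A => Structure.funMap F ![a, b, c]} where
  image A B f hf hA := by
    have hmap : ∀ a b c : A, Structure.funMap F ![f a, f b, f c] =
        f (Structure.funMap F ![a, b, c]) := by
      intro a b c
      rw [f.map_fun]
      congr 1
      ext i
      fin_cases i <;> rfl
    refine ⟨hf.forall₂.2 fun a b => ?_, hf.forall₂.2 fun a b => ?_, hf.forall₂.2 fun a b => ?_⟩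
    · exact (hmap _ _ _).trans (congrArg f (hA.1 a b))
    · exact (hmap _ _ _).trans (congrArg f (hA.2.1 a b))
    · exact (hmap _ _ _).trans (congrArg f (hA.2.2 a b))
  subalgebra A S hA := by
    have hmap : ∀ a b c : S, ((Structure.funMap F ![a, b, c] : S) : A) =
        Structure.funMap F ![(a : A), b, c] := by
      intro a b c
      refine (S.subtype.map_fun F _).trans ?_
      congr 1
      ext i
      fin_cases i <;> rfl
    refine ⟨fun a b => Subtype.ext ?_, fun a b => Subtype.ext ?_, fun a b => Subtype.ext ?_⟩
    · exact (hmap _ _ _).trans (hA.1 a.1 b.1)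
    · exact (hmap _ _ _).trans (hA.2.1 a.1 b.1)
    · exact (hmap _ _ _).trans (hA.2.2 a.1 b.1)
  product I A hA := by
    have hmap : ∀ (a b c : ∀ i, A i) (i : I),
        (Structure.funMap F ![a, b, c] : ∀ i, A i) i = Structure.funMap F ![a i, b i, c i] := by
      intro a b c i
      change Structure.funMap F (fun k => _) = _
      congr 1
      ext k
      fin_cases k <;> rfl
    refine ⟨fun a b => funext fun i => ?_, fun a b => funext fun i => ?_,
      fun a b => funext fun i => ?_⟩
    · exact (hmap _ _ _ i).trans ((hA i).1 (a i) (b i))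
    · exact (hmap _ _ _ i).trans ((hA i).2.1 (a i) (b i))
    · exact (hmap _ _ _ i).trans ((hA i).2.2 (a i) (b i))

end

/-! ### The variety generated by the polymorphism algebra -/

section

variable {V : Type u} (G : Digraph V)

/-- The algebra of ternary polymorphisms, as a subalgebra of a power of the polymorphism
algebra. -/
def ternaryPolymorphisms :
    (polymorphismLanguage G).Substructure
      (Bundled.of (c := (polymorphismLanguage G).Structure)
        (∀ i : Fin 3 → V, (fun _ => polymorphismAlgebra G) i)) where
  carrier := {f : (Fin 3 → V) → V | IsPolymorphism G f}
  fun_mem F _ hx a b hab := F.2 _ _ fun k => hx k a b hab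

/-- The congruence on ternary polymorphisms that relates operations agreeing on a set of
triples. -/
def agreeCongruence (T : Set (Fin 3 → V)) :
    Congruence (polymorphismLanguage G) (ternaryPolymorphisms G) where
  r f g := ∀ t ∈ T, f.1 t = g.1 t
  iseqv :=
    { refl := fun _ _ _ => rfl
      symm := fun h t ht => (h t ht).symm
      trans := fun h h' t ht => (h t ht).trans (h' t ht) }
  funMap_rel F _ _ h t ht := congrArg F.1 (funext fun k => h k t ht)

variable {G}

/-- If the variety generated by the polymorphism algebra is congruence permutable, then the
digraph has a Maltsev polymorphism. -/
theorem exists_maltsev_of_isCongruencePermutable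
    (h : IsCongruencePermutable (varietyGeneratedBy (polymorphismAlgebra G))) :
    ∃ m, IsMaltsev m ∧ IsTernaryPolymorphism G m := by
  have hV := isVariety_varietyGeneratedBy (polymorphismAlgebra G)
  have hmem := hV.subalgebra _ (ternaryPolymorphisms G)
    (hV.product (Fin 3 → V) (fun _ => polymorphismAlgebra G)
      fun _ => mem_varietyGeneratedBy (polymorphismAlgebra G))
  let θ := agreeCongruence G {t | t 0 = t 1}
  let φ := agreeCongruence G {t | t 1 = t 2}
  let π (k : Fin 3) : ternaryPolymorphisms G := ⟨fun t => t k, fun _ _ hab => hab k⟩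
  -- Permuting the chain π 0, π 1, π 2 yields `p` equal to π 0 where t 1 = t 2 and to π 2 where t 0
  -- = t 1: the two Maltsev identities.
  have hπ : Relation.Comp θ.r φ.r (π 0) (π 2) := ⟨π 1, fun _ ht => ht, fun _ ht => ht⟩
  obtain ⟨p, hp₀, hp₂⟩ := (congrFun₂ (h _ hmem θ φ) (π 0) (π 2)).mp hπ
  have hp : IsPolymorphism G p.1 := p.2
  refine ⟨fun a b c => p.1 ![a, b, c], ⟨fun a b => ?_, fun a b => ?_⟩, ?_⟩
  · exact (hp₀ ![a, b, b] rfl).symm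
  · exact hp₂ ![a, a, b] rfl
  · intro a b c a' b' c' ha hb hc
    refine hp _ _ fun i => ?_
    fin_cases i
    exacts [ha, hb, hc]

/-- If the digraph has a majority polymorphism and the variety generated by its polymorphism
algebra is congruence permutable, then the variety is congruence distributive. -/
theorem isCongruenceDistributive_of_majority
    (h : IsCongruencePermutable (varietyGeneratedBy (polymorphismAlgebra G)))
    (hf : ∃ f, IsMajority f ∧ IsTernaryPolymorphism G f) :
    IsCongruenceDistributive (varietyGeneratedBy (polymorphismAlgebra G)) := by
  obtain ⟨f, hf, hG⟩ := hf
  let F : (polymorphismLanguage G).Functions 3 :=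
    ⟨fun t => f (t 0) (t 1) (t 2), fun _ _ hab => hG (hab 0) (hab 1) (hab 2)⟩
  intro A hA
  -- The algebras where `F` is a majority operation form a variety containing the polymorphism
  -- algebra, hence containing `A`.
  exact Congruence.inf_sup_of_majority F (hA _ ⟨isVariety_majority F, hf⟩) (h A hA)

end

end UniversalAlgebra

theorem mainTheorem2 {V : Type u} [Finite V] (G : Digraph V) :
    UniversalAlgebra.IsCongruencePermutable
        (UniversalAlgebra.varietyGeneratedBy (UniversalAlgebra.polymorphismAlgebra G)) ↔
      UniversalAlgebra.IsArithmetic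
        (UniversalAlgebra.varietyGeneratedBy (UniversalAlgebra.polymorphismAlgebra G)) :=
  ⟨fun h => ⟨h, UniversalAlgebra.isCongruenceDistributive_of_majority h
    (UniversalAlgebra.exists_majority_of_maltsev G
      (UniversalAlgebra.exists_maltsev_of_isCongruencePermutable h))⟩, fun h => h.1⟩
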